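/- Let $\mathcal{H}_d$ be the real vector space of Hermitian matrices in $\mathbb{C}^{d\times d}$, with the Hilbert--Schmidt norm. Let $\rho_0,H_0\in\mathcal{H}_d$, let $S\subseteq\mathcal{H}_d$, let $T:\mathcal{H}_d\to\mathcal{H}_d$ be a real-linear map with $T(\mathbb{1})=\mathbb{1}$, and let $\delta$ be the degree of the minimal polynomial of $T$. Consider the two maps $$S\ni\rho\mapsto\big(\mathrm{tr}[\rho\,T^i(H_0)]\big)_{i=0}^\infty,\qquad S\ni H\mapsto\big(\mathrm{tr}[\rho_0\,T^i(H)]\big)_{i=0}^\infty$$ into the space $\mathbb{R}^{\infty}$ of real sequences. (1) If $S$, with the subspace topology, is a non-empty topological manifold (without boundary) of dimension $n>\delta$, then neither of the two maps is injective. (2) For a bounded set $S$ and $\epsilon>0$ let $N(\epsilon,S)$ be the least number of open balls of radius $\epsilon$ with centres in $S$ that cover $S$, and let $D(S)=\limsup_{\epsilon\to0^+}\frac{\ln N(\epsilon,S)}{\ln(1/\epsilon)}$ be the Minkowski dimension of $S$. If $S$ is bounded and $D(S)>\delta$, then neither of the two maps has a Lipschitz continuous inverse on its image. Here distances between sequences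 are measured by an arbitrary norm, or just a seminorm: for every linear subspace $W\subseteq\mathbb{R}^\infty$ that contains all sequences in the image of the map, and every seminorm $p$ on $W$, there are no left inverse $g$ of the map, defined on its image, and constant $L$ with $\|g(a)-g(b)\|\le L\,p(a-b)$ for all $a,b$ in the image. (For instance, $p$ may be the supremum norm if the sequences are bounded, or $p(a)=\max_{i<m}|a_i|$.) -/

import Mathlib

open Topology Filter

/- Hermitian matrices are metrised by the Hilbert-Schmidt (Frobenius) norm. -/
attribute [local instance] Matrix.frobeniusNormedAddCommGroup
attribute [local instance] Matrix.frobeniusNormedSpace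

namespace QuantumSeries

noncomputable section

/-- The real vector space of Hermitian `d × d` complex matrices. -/
abbrev Herm (d : ℕ) : Type := selfAdjoint (Matrix (Fin d) (Fin d) ℂ)

/-- The set of unital, Hermiticity preserving linear maps. (Hermiticity preservation is
built into the type: `T` is a real-linear map from Hermitian matrices to Hermitian matrices.) -/
def unitalMaps (d : ℕ) : Set (Module.End ℝ (Herm d)) := {T | T 1 = 1}

/-- The degree of the minimal polynomial of `T`. -/
def minpolyDegree {d : ℕ} (T : Module.End ℝ (Herm d)) : ℕ := (minpoly ℝ T).natDegree

/-- The Hilbert-Schmidt pairing `tr (ρ H)` of two Hermitian matrices, a real number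
(see `trace_mul_eq_pairing`). -/
def pairing {d : ℕ} (ρ H : Herm d) : ℝ :=
  (Matrix.trace ((ρ : Matrix (Fin d) (Fin d) ℂ) * (H : Matrix (Fin d) (Fin d) ℂ))).re

/-- Taking the real part in `pairing` loses nothing. -/
theorem trace_mul_eq_pairing {d : ℕ} (ρ H : Herm d) :
    Matrix.trace ((ρ : Matrix (Fin d) (Fin d) ℂ) * (H : Matrix (Fin d) (Fin d) ℂ))
      = (pairing ρ H : ℂ) := by
  have hρ : (ρ : Matrix (Fin d) (Fin d) ℂ).conjTranspose = ρ := ρ.2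
  have hH : (H : Matrix (Fin d) (Fin d) ℂ).conjTranspose = H := H.2
  have h : star (Matrix.trace ((ρ : Matrix (Fin d) (Fin d) ℂ) * (H : Matrix (Fin d) (Fin d) ℂ)))
      = Matrix.trace ((ρ : Matrix (Fin d) (Fin d) ℂ) * (H : Matrix (Fin d) (Fin d) ℂ)) := by
    rw [← Matrix.trace_conjTranspose, Matrix.conjTranspose_mul, hρ, hH, Matrix.trace_mul_comm]
  exact (Complex.conj_eq_iff_re.mp h).symm

/-- The time series `(tr (ρ T^i(H)))_{i = 0, 1, 2, …}`. -/
def timeSeries {d : ℕ} (T : Module.End ℝ (Herm d)) (ρ H : Herm d) : ℕ → ℝ :=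
  fun i => pairing ρ ((T ^ i) H)

/-- The least number of open balls of radius `ε`, centred in `S`, that cover `S`
(`⊤` if no finite number suffices). -/
def openCoveringNumber {X : Type*} [PseudoMetricSpace X] (ε : ℝ) (S : Set X) : ℕ∞ :=
  ⨅ (C : Set X) (_ : C ⊆ S) (_ : S ⊆ ⋃ x ∈ C, Metric.ball x ε), C.encard

/-- The Minkowski (upper box counting) dimension
`limsup_{ε → 0+} ln N(ε, S) / ln (1 / ε)`, as an extended real number. -/
def minkowskiDim {X : Type*} [PseudoMetricSpace X] (S : Set X) : EReal :=
  limsup (fun ε : ℝ =>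
    ENNReal.log ((openCoveringNumber ε S : ℕ∞) : ENNReal) / ((Real.log (1 / ε) : ℝ) : EReal))
    (𝓝[>] (0 : ℝ))

/-- `f : X → F` has an inverse, defined on its image, which is Lipschitz continuous with respect
to the distance `p (a - b)` on the image. -/
def HasLipschitzInverse {X F : Type*} [PseudoMetricSpace X] [AddCommGroup F] [Module ℝ F]
    (p : Seminorm ℝ F) (f : X → F) : Prop :=
  ∃ g : Set.range f → X, (∀ x : X, g ⟨f x, Set.mem_range_self x⟩ = x) ∧
    ∃ L : ℝ, ∀ a b : Set.range f, dist (g a) (g b) ≤ L * p ((a : F) - (b : F))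

end

end QuantumSeries

/-! ### Average Jacobian of C¹ maps that fix the unit sphere. -/

section NoRetraction

open MeasureTheory Metric

/-! Modulo the minimal polynomial, every power of `T` is a combination of the first δ powers, so a
series vanishes once its first δ entries do. Both maps are linear, so their injectivity on S is that
of a continuous map into ℝ^δ.

(1) Injectivity would embed a closed ball of dimension n > δ into ℝ^δ. Smoothing this embedding and
an extension of its inverse gives a C¹ retraction onto a sphere. That is impossible: a C¹ map fixing
the unit sphere has average Jacobian 1, a sphere-valued one has Jacobian 0
(`ContinuousOn.not_injOn_closedBall_of_finrank_lt`).

(2) The possible series form a finite-dimensional space, where every seminorm is dominated by the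
norm of the first δ entries. A Lipschitz inverse therefore pulls grid cells in ℝ^δ back to a cover
of S by O(ε^(-δ)) balls, forcing D(S) ≤ δ (`minkowskiDim_le`). -/

theorem LinearMap.exists_polynomial_eval_eq_det_one_add_smul {R M : Type*} [CommRing R]
    [Nontrivial R] [AddCommGroup M] [Module R M] [Module.Free R M] [Module.Finite R M]
    (A : M →ₗ[R] M) :
    ∃ p : Polynomial R, p.natDegree ≤ Module.finrank R M ∧
      ∀ t : R, p.eval t = LinearMap.det (1 + t • A) := by
  classical
  let b := Module.finBasis R M
  let B := LinearMap.toMatrix b b A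
  refine ⟨Matrix.det ((Polynomial.X : Polynomial R) • B.map Polynomial.C +
    (1 : Matrix _ _ R).map Polynomial.C), ?_, fun t => ?_⟩
  · simpa using Polynomial.natDegree_det_X_add_C_le B 1
  · rw [← LinearMap.det_toMatrix b, ← Polynomial.coe_evalRingHom, RingHom.map_det]
    congr 1
    ext i j
    simp only [RingHom.mapMatrix_apply, Matrix.map_apply, Matrix.add_apply, Matrix.smul_apply,
      map_add, smul_eq_mul, Polynomial.coe_evalRingHom, Polynomial.eval_mul, Polynomial.eval_X,
      Polynomial.eval_C, map_smul, LinearMap.toMatrix_one, B]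
    exact add_comm _ _

/-- `det (1 + A)` is a fixed affine combination of the numbers `det (1 + t • A)`, where `t` runs
through finitely many nodes that may be chosen as close to `0` as desired. -/
theorem LinearMap.exists_nodes_det_one_add_eq_sum (M : Type*) [AddCommGroup M] [Module ℝ M]
    [Module.Finite ℝ M] {r : ℝ} (hr : 0 < r) :
    ∃ (s : Finset ℕ) (v w : ℕ → ℝ), (∀ i, v i ∈ Set.Ioo 0 r) ∧ ∑ i ∈ s, w i = 1 ∧
      ∀ A : M →ₗ[ℝ] M, LinearMap.det (1 + A) = ∑ i ∈ s, w i * LinearMap.det (1 + v i • A) := by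
  let s := Finset.range (Module.finrank ℝ M + 1)
  -- Degree at most `finrank` needs `finrank + 1` distinct nodes; the shift by 2 keeps even the
  -- first one below `r`.
  let v : ℕ → ℝ := fun i => r / (i + 2)
  have hv : Set.InjOn v s := by
    intro i _ j _ hij
    have hi : (i : ℝ) + 2 ≠ 0 := by positivity
    have hj : (j : ℝ) + 2 ≠ 0 := by positivity
    simp only [v] at hij
    rw [div_eq_div_iff hi hj] at hij
    have := mul_left_cancel₀ hr.ne' hij
    exact_mod_cast (add_right_cancel this).symm
  refine ⟨s, v, fun i => (Lagrange.basis s v i).eval 1, fun i => ⟨by positivity, ?_⟩, ?_, ?_⟩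
  · have : (0 : ℝ) ≤ i := i.cast_nonneg
    exact div_lt_self hr (by linarith)
  · rw [← Polynomial.eval_finsetSum, Lagrange.sum_basis hv ⟨0, by simp [s]⟩, Polynomial.eval_one]
  · intro A
    obtain ⟨p, hp, hpA⟩ := A.exists_polynomial_eval_eq_det_one_add_smul
    have hdeg : p.degree < s.card := by
      rw [Finset.card_range]
      exact (Polynomial.degree_le_of_natDegree_le hp).trans_lt (by exact_mod_cast Nat.lt_succ_self _)
    have h := congrArg (Polynomial.eval 1) (Lagrange.eq_interpolate hv hdeg)
    rw [hpA, one_smul, Lagrange.interpolate_apply, Polynomial.eval_finsetSum] at h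
    rw [h]
    refine Finset.sum_congr rfl fun i _ => ?_
    rw [Polynomial.eval_mul, Polynomial.eval_C, hpA, mul_comm]

variable {E : Type*} [NormedAddCommGroup E] [NormedSpace ℝ E]

/-- Extending by zero a Lipschitz map that vanishes on the unit sphere. -/
theorem LipschitzOnWith.indicator_ball {F : Type*} [NormedAddCommGroup F] [Nontrivial E]
    {g : E → F} {K : NNReal} (hg : LipschitzOnWith K g (closedBall 0 1))
    (h0 : ∀ x ∈ sphere (0 : E) 1, g x = 0) :
    LipschitzWith K ((ball (0 : E) 1).indicator g) := by
  have key : ∀ x ∈ ball (0 : E) 1, ∀ y ∉ ball (0 : E) 1, dist (g x) 0 ≤ K * dist x y := by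
    intro x hx y hy
    -- The radial projection `z` of `x` is nearest on the sphere: `1 - ‖x‖ ≤ dist x y` for all `y`
    -- outside the ball.
    obtain ⟨z, hz, hxz⟩ : ∃ z ∈ sphere (0 : E) 1, dist x z = 1 - ‖x‖ := by
      rcases eq_or_ne x 0 with rfl | hx0
      · obtain ⟨z, hz⟩ := exists_norm_eq E zero_le_one
        exact ⟨z, by simpa using hz, by simp [hz]⟩
      · have hn : 0 < ‖x‖ := norm_pos_iff.2 hx0
        refine ⟨‖x‖⁻¹ • x, by simp [norm_smul, hn.ne'], ?_⟩
        have h1 : ‖x‖ < 1 := by simpa using hx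
        have : x - ‖x‖⁻¹ • x = (1 - ‖x‖⁻¹) • x := by rw [sub_smul, one_smul]
        have h2 : 1 ≤ ‖x‖⁻¹ := (one_le_inv₀ hn).2 h1.le
        rw [dist_eq_norm, this, norm_smul, Real.norm_eq_abs, abs_of_nonpos (by linarith)]
        field_simp
        ring
    have h1 := hg.dist_le_mul x (ball_subset_closedBall hx) z (sphere_subset_closedBall hz)
    rw [h0 z hz, hxz] at h1
    refine h1.trans (mul_le_mul_of_nonneg_left ?_ K.coe_nonneg)
    have hy1 : 1 ≤ ‖y‖ := by simpa using hy
    have := norm_sub_norm_le y x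
    rw [dist_comm, dist_eq_norm]
    linarith
  refine LipschitzWith.of_dist_le_mul fun x y => ?_
  by_cases hx : x ∈ ball (0 : E) 1 <;> by_cases hy : y ∈ ball (0 : E) 1
  · rw [Set.indicator_of_mem hx, Set.indicator_of_mem hy]
    exact hg.dist_le_mul x (ball_subset_closedBall hx) y (ball_subset_closedBall hy)
  · rw [Set.indicator_of_mem hx, Set.indicator_of_notMem hy]
    exact key x hx y hy
  · rw [Set.indicator_of_notMem hx, Set.indicator_of_mem hy, dist_comm, dist_comm x]
    exact key y hy x hx
  · rw [Set.indicator_of_notMem hx, Set.indicator_of_notMem hy, dist_self]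
    positivity

/-- A perturbation of the identity by a contraction that vanishes on the unit sphere permutes
the open unit ball. -/
theorem LipschitzOnWith.bijOn_ball_add [CompleteSpace E] [Nontrivial E]
    {g : E → E} {K : NNReal} (hg : LipschitzOnWith K g (closedBall 0 1)) (hK : K < 1)
    (h0 : ∀ x ∈ sphere (0 : E) 1, g x = 0) :
    Set.BijOn (fun x => x + g x) (ball (0 : E) 1) (ball 0 1) := by
  have hl := hg.indicator_ball h0
  set G := (ball (0 : E) 1).indicator g with hG
  have happ : ApproximatesLinearOn (fun x => x + G x)
      ((ContinuousLinearEquiv.refl ℝ E : E ≃L[ℝ] E) : E →L[ℝ] E) Set.univ K := by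
    rw [ApproximatesLinearOn.approximatesLinearOn_iff_lipschitzOnWith, lipschitzOnWith_univ]
    convert hl using 1
    ext x
    simp
  have hc : Subsingleton E ∨
      K < ‖(((ContinuousLinearEquiv.refl ℝ E).symm : E ≃L[ℝ] E) : E →L[ℝ] E)‖₊⁻¹ := by
    right
    have : ‖(((ContinuousLinearEquiv.refl ℝ E).symm : E ≃L[ℝ] E) : E →L[ℝ] E)‖₊ = 1 := by
      ext
      exact ContinuousLinearMap.norm_id
    rw [this, inv_one]
    exact hK
  have hinj : Function.Injective (fun x => x + G x) := by
    have := happ.injOn hc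
    exact Set.injOn_univ.1 this
  have hsurj := happ.surjective hc
  have hout : ∀ x ∉ ball (0 : E) 1, x + G x = x := fun x hx => by
    rw [hG, Set.indicator_of_notMem hx, add_zero]
  -- A bijection of `E` that is the identity off the ball must permute the ball.
  have hb : Set.BijOn (fun x => x + G x) (ball (0 : E) 1) (ball 0 1) := by
    refine ⟨fun x hx => ?_, hinj.injOn, fun y hy => ?_⟩
    · by_contra hx'
      have := hinj (hout _ hx')
      simp only at this hx'
      rw [this] at hx'
      exact hx' hx
    · obtain ⟨x, hx⟩ := hsurj y
      refine ⟨x, ?_, hx⟩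
      by_contra hx'
      have := hout x hx'
      simp only at hx
      rw [← this, hx] at hx'
      exact hx' hy
  refine hb.congr fun x hx => ?_
  simp only [hG, Set.indicator_of_mem hx]

variable [FiniteDimensional ℝ E]

/-- A `C¹` map which is the identity on the unit sphere has average Jacobian `1` on the unit
ball. -/
theorem integral_det_fderiv_eq_of_eq_on_sphere [MeasurableSpace E] [BorelSpace E]
    [Nontrivial E] (μ : Measure E) [μ.IsAddHaarMeasure] {f : E → E} (hf : ContDiff ℝ 1 f)
    (hs : ∀ x ∈ sphere (0 : E) 1, f x = x) :
    ∫ x in ball (0 : E) 1, (fderiv ℝ f x).det ∂μ = μ.real (ball 0 1) := by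
  set g : E → E := fun x => f x - x with hgdef
  have hgc : ContDiff ℝ 1 g := hf.sub contDiff_id
  have hg0 : ∀ x ∈ sphere (0 : E) 1, g x = 0 := fun x hx => by simp [hgdef, hs x hx]
  have hfd : ∀ x, fderiv ℝ f x = 1 + fderiv ℝ g x := by
    intro x
    have h := (hasFDerivAt_id x).add (hgc.differentiable one_ne_zero x).hasFDerivAt
    have hfg : id + g = f := by ext; simp [hgdef]
    rw [hfg] at h
    exact h.fderiv
  have hcont : Continuous (fderiv ℝ g) := hgc.continuous_fderiv one_ne_zero
  obtain ⟨C, hC⟩ := (isCompact_closedBall (0 : E) 1).exists_bound_of_continuousOn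
    hcont.continuousOn
  let K : NNReal := ⟨max C 0, le_max_right _ _⟩
  have hlip : LipschitzOnWith K g (closedBall 0 1) := by
    refine (convex_closedBall (0 : E) 1).lipschitzOnWith_of_nnnorm_fderiv_le
      (fun x _ => hgc.differentiable one_ne_zero x) fun x hx => ?_
    exact (hC x hx).trans (le_max_left _ _)
  obtain ⟨δ, hδ, hdet⟩ : ∃ δ > 0, ∀ A : E →L[ℝ] E, ‖A‖ < δ → 0 < (1 + A).det := by
    have h1 : ContinuousAt (fun A : E →L[ℝ] E => (1 + A).det) 0 :=
      (ContinuousLinearMap.continuous_det.comp (continuous_const.add continuous_id)).continuousAt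
    have h2 : ∀ᶠ A in 𝓝 (0 : E →L[ℝ] E), 0 < (1 + A).det := by
      refine h1.eventually (lt_mem_nhds ?_)
      simp [ContinuousLinearMap.det]
    obtain ⟨δ, hδ, h⟩ := Metric.eventually_nhds_iff.1 h2
    exact ⟨δ, hδ, fun A hA => h (by simpa using hA)⟩
  have hKpos : (0 : ℝ) < K + 1 := by positivity
  -- For these nodes `t * K < min 1 δ`: below 1, `id + t • g` permutes the ball; below `δ`, its
  -- Jacobian is positive. Its integral is then the volume, and interpolation carries this to `t =
  -- 1`.
  obtain ⟨s, v, w, hv, hw, hsum⟩ := LinearMap.exists_nodes_det_one_add_eq_sum E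
    (r := min 1 δ / (K + 1)) (by positivity)
  have hcd : ∀ t : ℝ, Continuous fun x => (1 + t • fderiv ℝ g x).det := fun t =>
    ContinuousLinearMap.continuous_det.comp (continuous_const.add (hcont.const_smul t))
  have hint : ∀ t : ℝ, IntegrableOn (fun x => (1 + t • fderiv ℝ g x).det) (ball (0 : E) 1) μ :=
    fun t => ((hcd t).continuousOn.integrableOn_compact
      (isCompact_closedBall (0 : E) 1)).mono_set ball_subset_closedBall
  have hnode : ∀ i, ∫ x in ball (0 : E) 1, (1 + v i • fderiv ℝ g x).det ∂μ
      = μ.real (ball 0 1) := by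
    intro i
    obtain ⟨ht0, ht⟩ := hv i
    set t := v i
    rw [lt_div_iff₀ hKpos] at ht
    have htK : t * K < min 1 δ := by nlinarith
    have hlt : LipschitzOnWith (Real.toNNReal t * K) (fun x => t • g x) (closedBall 0 1) := by
      refine LipschitzOnWith.of_dist_le_mul fun x hx y hy => ?_
      rw [dist_smul₀, NNReal.coe_mul, Real.coe_toNNReal _ ht0.le, mul_assoc, Real.norm_eq_abs,
        abs_of_pos ht0]
      exact mul_le_mul_of_nonneg_left (hlip.dist_le_mul x hx y hy) ht0.le
    have hbij := hlt.bijOn_ball_add (by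
      rw [← NNReal.coe_lt_coe, NNReal.coe_mul, Real.coe_toNNReal _ ht0.le]
      exact htK.trans_le (min_le_left _ _)) (fun x hx => by rw [hg0 x hx, smul_zero])
    have hder : ∀ x ∈ ball (0 : E) 1, HasFDerivWithinAt (fun x => x + t • g x)
        (1 + t • fderiv ℝ g x) (ball 0 1) x := fun x _ =>
      ((hasFDerivAt_id x).add
        ((hgc.differentiable one_ne_zero x).hasFDerivAt.const_smul t)).hasFDerivWithinAt
    have hvol := lintegral_abs_det_fderiv_eq_addHaar_image μ measurableSet_ball hder hbij.injOn
    rw [hbij.image_eq] at hvol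
    have hpos : ∀ x ∈ ball (0 : E) 1, 0 < (1 + t • fderiv ℝ g x).det := by
      intro x hx
      refine hdet _ ?_
      rw [norm_smul, Real.norm_eq_abs, abs_of_pos ht0]
      refine lt_of_le_of_lt ?_ (htK.trans_le (min_le_right _ _))
      exact mul_le_mul_of_nonneg_left
        ((hC x (ball_subset_closedBall hx)).trans (le_max_left _ _)) ht0.le
    rw [integral_eq_lintegral_of_nonneg_ae, measureReal_def, ← hvol]
    · congr 1
      refine setLIntegral_congr_fun measurableSet_ball fun x hx => ?_
      rw [abs_of_pos (hpos x hx)]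
    · exact (ae_restrict_mem measurableSet_ball).mono fun x hx => (hpos x hx).le
    · exact (hcd t).aestronglyMeasurable
  have hfun : ∀ x, (fderiv ℝ f x).det = ∑ i ∈ s, w i * (1 + v i • fderiv ℝ g x).det := by
    intro x
    rw [hfd]
    exact hsum (fderiv ℝ g x : E →ₗ[ℝ] E)
  simp_rw [hfun]
  rw [integral_finsetSum _ fun i _ => (hint (v i)).const_mul (w i)]
  simp_rw [integral_const_mul, hnode]
  rw [← Finset.sum_mul, hw, one_mul]

end NoRetraction

/-! ### No-retraction theorem and invariance of dimension. -/

/-- There is no `C¹` retraction of a Euclidean space onto its unit sphere. -/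
theorem ContDiff.exists_ne_of_norm_eq_one {E : Type*} [NormedAddCommGroup E]
    [InnerProductSpace ℝ E] [FiniteDimensional ℝ E] [Nontrivial E] {f : E → E}
    (hf : ContDiff ℝ 1 f) (h1 : ∀ x, ‖f x‖ = 1) : ∃ x ∈ Metric.sphere (0 : E) 1, f x ≠ x := by
  by_contra! hs
  borelize E
  have h := integral_det_fderiv_eq_of_eq_on_sphere (MeasureTheory.Measure.addHaar) hf hs
  have hdet : ∀ x, (fderiv ℝ f x).det = 0 := by
    intro x
    -- If the derivative were invertible, some `y` would be sent to `f x`; differentiating `‖f‖ ^ 2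
    -- = 1` along `y` gives `‖f x‖ ^ 2 = 0`.
    by_contra hne
    obtain ⟨y, hy⟩ := (LinearMap.equivOfDetNeZero _ hne).surjective (f x)
    have hy' : fderiv ℝ f x y = f x := hy
    have hd : HasFDerivAt f (fderiv ℝ f x) x := (hf.differentiable one_ne_zero x).hasFDerivAt
    have h2 : HasFDerivAt (fun z => ‖f z‖ ^ 2) (2 • (innerSL ℝ (f x)).comp (fderiv ℝ f x)) x :=
      hd.norm_sq
    have h3 : (fun z => ‖f z‖ ^ 2) = fun _ => (1 : ℝ) := by ext z; simp [h1]
    rw [h3] at h2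
    have h4 := congrArg (fun A : E →L[ℝ] ℝ => A y) (h2.unique (hasFDerivAt_const _ _))
    simp [hy', h1] at h4
  simp only [hdet, MeasureTheory.integral_zero] at h
  have : 0 < (MeasureTheory.Measure.addHaar : MeasureTheory.Measure E).real
      (Metric.ball 0 1) := ENNReal.toReal_pos
    (Metric.measure_ball_pos _ _ one_pos).ne' MeasureTheory.measure_ball_lt_top.ne
  exact this.ne h

/-- The closed unit ball of a Euclidean space does not embed into a space of lower dimension. -/
theorem ContinuousOn.not_injOn_closedBall_of_finrank_lt {E F : Type*} [NormedAddCommGroup E]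
    [InnerProductSpace ℝ E] [FiniteDimensional ℝ E] [NormedAddCommGroup F] [NormedSpace ℝ F]
    [FiniteDimensional ℝ F] (hFE : Module.finrank ℝ F < Module.finrank ℝ E) {h : E → F}
    (hc : ContinuousOn h (Metric.closedBall 0 1)) :
    ¬ Set.InjOn h (Metric.closedBall 0 1) := by
  intro hinj
  have : Nontrivial E := Module.nontrivial_of_finrank_pos (R := ℝ) (by omega)
  set B := Metric.closedBall (0 : E) 1 with hB
  have hBc : IsCompact B := isCompact_closedBall 0 1
  have : CompactSpace B := isCompact_iff_compactSpace.1 hBc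
  have hcr : Continuous (B.domRestrict h) := continuousOn_iff_continuous_domRestrict.1 hc
  have hemb : IsClosedEmbedding (B.domRestrict h) :=
    hcr.isClosedEmbedding (Set.injOn_iff_injective.1 hinj)
  -- Tietze: `G` extends the inverse of `h` to `F`, and `H` extends `h` to `E`.
  obtain ⟨G, hG⟩ := ContinuousMap.exists_extension' hemb
    (⟨Subtype.val, continuous_subtype_val⟩ : C(B, E))
  obtain ⟨H, hH⟩ := ContinuousMap.exists_restrict_eq hBc.isClosed (⟨B.domRestrict h, hcr⟩ : C(B, F))
  have hGH : ∀ x ∈ B, G (H x) = x := by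
    intro x hx
    have h1 : H x = h x := congrArg (fun k : C(B, F) => k ⟨x, hx⟩) hH
    have h2 : G (h x) = x := congrFun hG ⟨x, hx⟩
    rw [h1, h2]
  obtain ⟨P, hP, hPG, -⟩ := G.continuous.exists_contDiff_approx 1
    (continuous_const (y := (1 / 8 : ℝ))) (fun _ => by norm_num)
  -- Uniformity is needed around `H '' B`, since `q x` may leave that compact set.
  obtain ⟨δ, hδ, hGδ⟩ := Metric.mem_uniformity_dist.1
    ((hBc.image H.continuous).uniformContinuousAt_of_continuousAt G
      (fun y _ => G.continuous.continuousAt) (Metric.dist_mem_uniformity (ε := 1 / 8) (by norm_num)))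
  obtain ⟨q, hq, hqH, -⟩ := H.continuous.exists_contDiff_approx 1
    (continuous_const (y := δ)) (fun _ => hδ)
  have hPq : ∀ x ∈ B, dist (P (q x)) x < 1 / 4 := by
    intro x hx
    have h1 : dist (G (H x)) (G (q x)) < 1 / 8 :=
      hGδ (by rw [dist_comm]; exact hqH x) (Set.mem_image_of_mem H hx)
    have h2 : dist (P (q x)) (G (q x)) < 1 / 8 := hPG (q x)
    rw [hGH x hx, dist_comm] at h1
    have := dist_triangle (P (q x)) (G (q x)) x
    linarith
  -- The C¹ image of the lower-dimensional `F` has dense complement, so `P ∘ q - c` has no zero for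
  -- some small `c`.
  obtain ⟨c, hcP, hc0⟩ := (ContDiff.dense_compl_range_of_finrank_lt_finrank hP hFE).exists_dist_lt
    0 (show (0 : ℝ) < 1 / 8 by norm_num)
  rw [dist_zero_left] at hc0
  -- `k` is `P ∘ q - c` for `‖x‖ ≤ 1/2` and the identity for `‖x‖ ≥ 1`. In between it moves `x` by
  -- less than 1/4 + 1/8 < 1/2 < `‖x‖`, so it never vanishes.
  let χ : ContDiffBump (0 : E) := ⟨1 / 2, 1, by norm_num, by norm_num⟩
  let k : E → E := fun x => x + χ x • (P (q x) - c - x)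
  have hk : ContDiff ℝ 1 k :=
    contDiff_id.add (χ.contDiff.smul (((hP.comp hq).sub contDiff_const).sub contDiff_id))
  have hout : ∀ x, 1 ≤ ‖x‖ → k x = x := by
    intro x hx
    have : χ x = 0 := χ.zero_of_le_dist (by simpa [χ] using hx)
    simp [k, this]
  have hk0 : ∀ x, k x ≠ 0 := by
    intro x hx0
    rcases le_or_gt ‖x‖ (1 / 2) with hx | hx
    · have : χ x = 1 := χ.one_of_mem_closedBall (by simpa [χ] using hx)
      simp only [k, this, one_smul, add_sub_cancel] at hx0
      exact hcP ⟨q x, sub_eq_zero.1 hx0⟩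
    rcases lt_or_ge ‖x‖ 1 with hx1 | hx1
    · have h1 := hPq x (by simpa [hB] using hx1.le)
      rw [dist_eq_norm] at h1
      have h2 : ‖P (q x) - c - x‖ < 1 / 2 := by
        have := norm_sub_le (P (q x) - x) c
        rw [sub_right_comm]
        linarith
      have h3 : ‖χ x • (P (q x) - c - x)‖ ≤ ‖P (q x) - c - x‖ := by
        rw [norm_smul, Real.norm_eq_abs, abs_of_nonneg χ.nonneg]
        exact mul_le_of_le_one_left (norm_nonneg _) χ.le_one
      rw [add_eq_zero_iff_eq_neg] at hx0
      rw [hx0, norm_neg] at hx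
      linarith
    · rw [hout x hx1] at hx0
      rw [hx0, norm_zero] at hx1
      linarith
  have hf : ContDiff ℝ 1 fun x => ‖k x‖⁻¹ • k x :=
    ((hk.norm ℝ hk0).inv fun x => norm_ne_zero_iff.2 (hk0 x)).smul hk
  obtain ⟨x, hx, hne⟩ := hf.exists_ne_of_norm_eq_one fun x => by
    rw [norm_smul, norm_inv, norm_norm, inv_mul_cancel₀ (norm_ne_zero_iff.2 (hk0 x))]
  have hx1 : ‖x‖ = 1 := by simpa using hx
  exact hne (by simp only [hout x hx1.ge, hx1, inv_one, one_smul])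

/-- A nonempty `n`-dimensional topological manifold admits no continuous injection into a real
vector space of dimension less than `n`. -/
theorem Continuous.not_injective_of_chartedSpace {X F : Type*} [TopologicalSpace X] [Nonempty X]
    {n : ℕ} [ChartedSpace (EuclideanSpace ℝ (Fin n)) X] [NormedAddCommGroup F] [NormedSpace ℝ F]
    [FiniteDimensional ℝ F] (hn : Module.finrank ℝ F < n) {f : X → F} (hf : Continuous f) :
    ¬ Function.Injective f := by
  intro hinj
  obtain ⟨x₀⟩ := ‹Nonempty X›
  let e := chartAt (EuclideanSpace ℝ (Fin n)) x₀
  obtain ⟨r, hr, hre⟩ := Metric.nhds_basis_closedBall.mem_iff.1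
    (e.open_target.mem_nhds (e.map_source (mem_chart_source _ x₀)))
  have hmaps : Set.MapsTo (fun y => e x₀ + r • y) (Metric.closedBall 0 1) e.target := by
    intro y hy
    refine hre ?_
    have hy1 : ‖y‖ ≤ 1 := by simpa using hy
    rw [Metric.mem_closedBall, dist_self_add_left, norm_smul, Real.norm_eq_abs, abs_of_pos hr]
    exact mul_le_of_le_one_right hr.le hy1
  have haff : Function.Injective fun y : EuclideanSpace ℝ (Fin n) => e x₀ + r • y := fun y z h =>
    smul_right_injective _ hr.ne' (add_left_cancel h)
  have hcont : ContinuousOn (fun y => f (e.symm (e x₀ + r • y))) (Metric.closedBall 0 1) :=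
    hf.comp_continuousOn (e.continuousOn_symm.comp (by fun_prop) hmaps)
  refine hcont.not_injOn_closedBall_of_finrank_lt (by simpa using hn) ?_
  exact hinj.comp_injOn (e.symm.injOn.comp haff.injOn hmaps)

/-! ### Linear algebra: minimal polynomials and seminorms. -/

/-- A linear functional that vanishes on the powers of `a` below the degree of the minimal
polynomial vanishes on all powers. -/
theorem LinearMap.map_pow_eq_zero_of_lt_natDegree_minpoly {K A V : Type*} [Field K] [Ring A]
    [Algebra K A] [AddCommGroup V] [Module K V] {a : A} (ha : IsIntegral K a) (φ : A →ₗ[K] V)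
    (h : ∀ j < (minpoly K a).natDegree, φ (a ^ j) = 0) (i : ℕ) : φ (a ^ i) = 0 := by
  have hm := minpoly.monic ha
  have h1 : a ^ i = Polynomial.aeval a ((Polynomial.X ^ i : Polynomial K) %ₘ minpoly K a) := by
    rw [Polynomial.aeval_modByMonic_eq_self_of_root (minpoly.aeval K a), map_pow,
      Polynomial.aeval_X]
  -- Minimal polynomial 1 means `A` is trivial, as for `d = 0`.
  by_cases h0 : minpoly K a = 1
  · have := minpoly.aeval K a
    rw [h0, map_one] at this
    rw [← one_mul (a ^ i), this, zero_mul, map_zero]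
  · rw [h1, Polynomial.aeval_eq_sum_range' (Polynomial.natDegree_modByMonic_lt _ hm h0), map_sum]
    refine Finset.sum_eq_zero fun j hj => ?_
    rw [map_smul, h j (Finset.mem_range.1 hj), smul_zero]

/-- A seminorm of a linear map is dominated by the norm of any finite-rank linear map with a
smaller kernel. -/
theorem Seminorm.exists_le_mul_norm_of_ker_le {V F G : Type*} [AddCommGroup V] [Module ℝ V]
    [AddCommGroup F] [Module ℝ F] [NormedAddCommGroup G] [NormedSpace ℝ G]
    [FiniteDimensional ℝ G] (p : Seminorm ℝ F) (f : V →ₗ[ℝ] F) (A : V →ₗ[ℝ] G)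
    (hker : LinearMap.ker A ≤ LinearMap.ker f) : ∃ C, 0 < C ∧ ∀ v, p (f v) ≤ C * ‖A v‖ := by
  -- By the kernel inclusion `f` factors through the range of `A` via a section `s`; there the
  -- seminorm is convex, hence continuous.
  obtain ⟨s, hs⟩ := A.rangeRestrict.exists_rightInverse_of_surjective A.range_rangeRestrict
  let q : Seminorm ℝ (LinearMap.range A) := (p.comp f).comp s
  obtain ⟨C, hC, hq⟩ := q.bound_of_continuous_normedSpace
    (continuousOn_univ.1 (q.convexOn.continuousOn isOpen_univ))
  refine ⟨C, hC, fun v => ?_⟩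
  have hv : f (s (A.rangeRestrict v)) = f v := by
    rw [← sub_eq_zero, ← map_sub]
    refine hker ?_
    have := congrArg Subtype.val (LinearMap.congr_fun hs (A.rangeRestrict v))
    rw [LinearMap.mem_ker, map_sub, sub_eq_zero]
    exact this
  have := hq (A.rangeRestrict v)
  simp only [q, Seminorm.comp_apply, hv] at this
  exact this

namespace QuantumSeries

/-! ### Covering numbers and Minkowski dimension. -/

section Covering

variable {X : Type*} [PseudoMetricSpace X]

/-- One point of `S` is chosen in each nonempty grid cell of side `ε / (2 * L)`; points sharing a
cell are within `ε / 2`, hence in a common open ball. -/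
theorem openCoveringNumber_le {S : Set X} {k : ℕ} {φ : X → Fin k → ℝ} {L R ε : ℝ} (hL : 0 < L)
    (hε : 0 < ε) (hR : ∀ x ∈ S, ∀ i, |φ x i| ≤ R)
    (hφ : ∀ x ∈ S, ∀ y ∈ S, dist x y ≤ L * dist (φ x) (φ y)) :
    openCoveringNumber ε S ≤
      (((Finset.Icc ⌊-R / (ε / (2 * L))⌋ ⌊R / (ε / (2 * L))⌋).card ^ k : ℕ) : ℕ∞) := by
  classical
  set η := ε / (2 * L) with hη
  have hηpos : 0 < η := by positivity
  let cell : X → Fin k → ℤ := fun x i => ⌊φ x i / η⌋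
  obtain ⟨C, hCS, hC⟩ := Set.exists_subset_bijOn S cell
  have hcells : cell '' S ⊆
      (Fintype.piFinset fun _ : Fin k => Finset.Icc ⌊-R / η⌋ ⌊R / η⌋ : Finset (Fin k → ℤ)) := by
    rintro _ ⟨x, hx, rfl⟩
    simp only [Finset.mem_coe, Fintype.mem_piFinset, Finset.mem_Icc]
    intro i
    obtain ⟨h1, h2⟩ := abs_le.1 (hR x hx i)
    exact ⟨Int.floor_mono (by gcongr), Int.floor_mono (by gcongr)⟩
  have hcard : C.encard ≤ (((Finset.Icc ⌊-R / η⌋ ⌊R / η⌋).card ^ k : ℕ) : ℕ∞) := by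
    rw [← hC.injOn.encard_image, hC.image_eq]
    refine (Set.encard_le_encard hcells).trans ?_
    rw [Set.encard_coe_eq_coe_finsetCard, Fintype.card_piFinset, Finset.prod_const,
      Finset.card_univ, Fintype.card_fin]
  refine le_trans ?_ hcard
  refine iInf_le_of_le C (iInf_le_of_le hCS (iInf_le_of_le (fun x hx => ?_) le_rfl))
  obtain ⟨y, hy, hyx⟩ := hC.surjOn (Set.mem_image_of_mem cell hx)
  refine Set.mem_biUnion hy ?_
  have hd : dist (φ x) (φ y) ≤ η := by
    refine (dist_pi_le_iff hηpos.le).2 fun i => ?_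
    have h2 := Int.abs_sub_lt_one_of_floor_eq_floor (congrFun hyx i).symm
    rw [← sub_div, abs_div, abs_of_pos hηpos, div_lt_one hηpos] at h2
    exact h2.le
  rw [Metric.mem_ball]
  calc dist x y ≤ L * η :=
        (hφ x hx y (hCS hy)).trans (mul_le_mul_of_nonneg_left hd hL.le)
    _ = ε / 2 := by rw [hη]; field_simp
    _ < ε := half_lt_self hε

/-- A set that embeds into a bounded subset of `ℝ ^ k` with a Lipschitz inverse has Minkowski
dimension at most `k`. -/
theorem minkowskiDim_le {S : Set X} {k : ℕ} {φ : X → Fin k → ℝ} {L R : ℝ} (hL : 0 < L)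
    (hR : ∀ x ∈ S, ∀ i, |φ x i| ≤ R)
    (hφ : ∀ x ∈ S, ∀ y ∈ S, dist x y ≤ L * dist (φ x) (φ y)) :
    minkowskiDim S ≤ k := by
  wlog hR0 : 0 ≤ R generalizing R
  · exact this (R := max R 0) (fun x hx i => (hR x hx i).trans (le_max_left _ _))
      (le_max_right _ _)
  -- Each axis meets at most `4 * R * L / ε + 2` cells, which is at most `M / ε` when `ε < 1`.
  set M : ℝ := 4 * R * L + 2 with hM
  have hMpos : 0 < M := by positivity
  have hbound : ∀ ε ∈ Set.Ioo (0 : ℝ) 1,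
      ENNReal.log ((openCoveringNumber ε S : ℕ∞) : ENNReal) / ((Real.log (1 / ε) : ℝ) : EReal)
        ≤ ((k * (Real.log M / Real.log (1 / ε) + 1) : ℝ) : EReal) := by
    rintro ε ⟨hε, hε1⟩
    have hlog : 0 < Real.log (1 / ε) := Real.log_pos ((one_lt_div hε).2 hε1)
    have hcard : ((Finset.Icc ⌊-R / (ε / (2 * L))⌋ ⌊R / (ε / (2 * L))⌋).card : ℝ) ≤ M / ε := by
      have h0 : (0 : ℝ) ≤ R / (ε / (2 * L)) := by positivity
      have h1 := Int.floor_le (R / (ε / (2 * L)))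
      have h2 := Int.lt_floor_add_one (-R / (ε / (2 * L)))
      have h3 : ⌊-R / (ε / (2 * L))⌋ ≤ ⌊R / (ε / (2 * L))⌋ + 1 := by
        refine (Int.floor_mono ?_).trans (Int.le_add_one le_rfl)
        gcongr
        linarith
      have h4 : ((Finset.Icc ⌊-R / (ε / (2 * L))⌋ ⌊R / (ε / (2 * L))⌋).card : ℝ)
          = ⌊R / (ε / (2 * L))⌋ + 1 - ⌊-R / (ε / (2 * L))⌋ := by
        exact_mod_cast Int.card_Icc_of_le _ _ h3
      rw [h4]
      have h5 : M / ε = 2 * (R / (ε / (2 * L))) + 2 / ε := by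
        rw [hM]; field_simp; ring
      have h6 : (2 : ℝ) ≤ 2 / ε := by
        rw [le_div_iff₀ hε]; linarith
      rw [neg_div] at h2 ⊢
      linarith
    have hN : ((openCoveringNumber ε S : ℕ∞) : ENNReal) ≤ ENNReal.ofReal ((M / ε) ^ k) := by
      refine (ENat.toENNReal_le.2 (openCoveringNumber_le hL hε hR hφ)).trans ?_
      rw [ENat.toENNReal_coe, ← ENNReal.ofReal_natCast]
      refine ENNReal.ofReal_le_ofReal ?_
      push_cast
      gcongr
    refine (EReal.div_le_div_right_of_nonneg (by exact_mod_cast hlog.le)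
      (ENNReal.log_monotone hN)).trans ?_
    rw [ENNReal.log_ofReal_of_pos (by positivity), ← EReal.coe_div, EReal.coe_le_coe_iff,
      Real.log_pow, div_eq_mul_one_div M ε, Real.log_mul hMpos.ne' (by positivity)]
    apply le_of_eq
    field_simp
  have hlim : Tendsto (fun ε : ℝ => ((k * (Real.log M / Real.log (1 / ε) + 1) : ℝ) : EReal))
      (𝓝[>] (0 : ℝ)) (𝓝 (k : EReal)) := by
    have h1 : Tendsto (fun ε : ℝ => Real.log (1 / ε)) (𝓝[>] (0 : ℝ)) atTop := by
      simp only [one_div]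
      exact Real.tendsto_log_atTop.comp tendsto_inv_nhdsGT_zero
    have h2 := (((tendsto_const_nhds (x := Real.log M)).div_atTop h1).add_const 1).const_mul
      (k : ℝ)
    rw [zero_add, mul_one] at h2
    exact (continuous_coe_real_ereal.tendsto _).comp h2
  refine (limsup_le_limsup ?_).trans hlim.limsup_eq.le
  exact mem_of_superset (Ioo_mem_nhdsGT one_pos) hbound

end Covering

/-! ### Sequences determined by their first `m` entries. -/

section Measurements

variable {V : Type*} [NormedAddCommGroup V] [NormedSpace ℝ V] [FiniteDimensional ℝ V]
  {m : ℕ} {f : V →ₗ[ℝ] ℕ → ℝ}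

theorem continuous_coordinate (f : V →ₗ[ℝ] ℕ → ℝ) (i : ℕ) : Continuous fun v => f v i :=
  LinearMap.continuous_of_finiteDimensional ((LinearMap.proj i).comp f)

theorem not_injOn_of_chartedSpace (hker : ∀ v, (∀ j < m, f v j = 0) → f v = 0) {S : Set V} (hS : S.Nonempty) {n : ℕ}
    (hM : Nonempty (ChartedSpace (EuclideanSpace ℝ (Fin n)) S)) (hn : m < n) :
    ¬ Set.InjOn f S := by
  intro hinj
  obtain ⟨hM⟩ := hM
  have := hS.to_subtype
  refine Continuous.not_injective_of_chartedSpace (X := S) (F := Fin m → ℝ) (n := n)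
    (f := fun v j => f v j) (by simpa using hn)
    (continuous_pi fun j => (continuous_coordinate f j).comp continuous_subtype_val) fun x y hxy => ?_
  refine Subtype.ext (hinj x.2 y.2 ?_)
  rw [← sub_eq_zero, ← map_sub]
  refine hker _ fun j hj => ?_
  rw [map_sub, Pi.sub_apply, sub_eq_zero]
  exact congrFun hxy ⟨j, hj⟩

theorem not_hasLipschitzInverse_of_lt_minkowskiDim
    (hker : ∀ v, (∀ j < m, f v j = 0) → f v = 0) {S : Set V} (hS : Bornology.IsBounded S)
    (hm : (m : EReal) < minkowskiDim S) (W : Submodule ℝ (ℕ → ℝ)) (p : Seminorm ℝ W)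
    (hW : ∀ v ∈ S, f v ∈ W) :
    ¬ HasLipschitzInverse p (fun v : S => (⟨f v, hW v v.2⟩ : W)) := by
  rintro ⟨g, hg, L, hL⟩
  let A : V →ₗ[ℝ] Fin m → ℝ := LinearMap.pi fun j => (LinearMap.proj (j : ℕ)).comp f
  -- `f` need not map all of `V` into `W`, but the subspace `W.comap f` contains `S`.
  let f' : W.comap f →ₗ[ℝ] W := f.restrict fun _ hx => hx
  obtain ⟨C, hC, hpC⟩ := p.exists_le_mul_norm_of_ker_le f' (A.comp (W.comap f).subtype) (by
    intro v hv
    refine Subtype.ext (hker v fun j hj => ?_)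
    exact congrFun (LinearMap.mem_ker.1 hv) ⟨j, hj⟩)
  let A' : V →L[ℝ] Fin m → ℝ := ⟨A, continuous_pi fun j => continuous_coordinate f j⟩
  obtain ⟨r, hr⟩ := isBounded_iff_forall_norm_le.1 hS
  -- `|L| + 1` replaces `L`, which may be nonpositive.
  refine hm.not_ge (minkowskiDim_le (φ := A) (L := (|L| + 1) * C) (R := ‖A'‖ * r)
    (by positivity) (fun x hx i => ?_) fun x hx y hy => ?_)
  · exact ((norm_le_pi_norm (A' x) i).trans (A'.le_opNorm x)).trans
      (mul_le_mul_of_nonneg_left (hr x hx) (norm_nonneg _))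
  · have h1 := hL ⟨_, Set.mem_range_self (⟨x, hx⟩ : S)⟩ ⟨_, Set.mem_range_self (⟨y, hy⟩ : S)⟩
    rw [hg, hg] at h1
    have h2 := hpC (⟨x, hW x hx⟩ - ⟨y, hW y hy⟩)
    rw [map_sub f', map_sub (A.comp (W.comap f).subtype), ← dist_eq_norm] at h2
    have h3 : (0 : ℝ) ≤ p (f' ⟨x, hW x hx⟩ - f' ⟨y, hW y hy⟩) := apply_nonneg _ _
    calc dist x y ≤ L * p (f' ⟨x, hW x hx⟩ - f' ⟨y, hW y hy⟩) := h1
      _ ≤ (|L| + 1) * p (f' ⟨x, hW x hx⟩ - f' ⟨y, hW y hy⟩) :=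
        mul_le_mul_of_nonneg_right (by linarith [le_abs_self L]) h3
      _ ≤ (|L| + 1) * (C * dist (A x) (A y)) := mul_le_mul_of_nonneg_left h2 (by positivity)
      _ = (|L| + 1) * C * dist (A x) (A y) := by ring

end Measurements

/-! ### Time series of Hermitian matrices. -/

variable {d : ℕ}

instance finiteDimensional_herm : FiniteDimensional ℝ (Herm d) :=
  FiniteDimensional.of_injective (V₂ := Matrix (Fin d) (Fin d) ℂ)
    { toFun := fun x => (x : Matrix (Fin d) (Fin d) ℂ)
      map_add' := fun _ _ => rfl
      map_smul' := fun _ _ => rfl } Subtype.val_injective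

/-- The Hilbert-Schmidt pairing as a bilinear form. -/
noncomputable def pairingForm (d : ℕ) : Herm d →ₗ[ℝ] Herm d →ₗ[ℝ] ℝ :=
  LinearMap.mk₂ ℝ pairing
    (fun _ _ _ => by simp [pairing, add_mul])
    (fun _ _ _ => by simp [pairing])
    (fun _ _ _ => by simp [pairing, mul_add])
    (fun _ _ _ => by simp [pairing])

/-- The time series as a bilinear map in the state and the observable. -/
noncomputable def timeSeriesForm (T : Module.End ℝ (Herm d)) : Herm d →ₗ[ℝ] Herm d →ₗ[ℝ] ℕ → ℝ :=
  LinearMap.mk₂ ℝ (timeSeries T)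
    (fun ρ ρ' _ => funext fun _ => LinearMap.map_add₂ (pairingForm d) ρ ρ' _)
    (fun c ρ _ => funext fun _ => LinearMap.map_smul₂ (pairingForm d) c ρ _)
    (fun ρ H H' => funext fun i => 
      (congrArg (pairing ρ) (map_add (T ^ i) H H')).trans (map_add (pairingForm d ρ) _ _))
    (fun c ρ H => funext fun i => 
      (congrArg (pairing ρ) (map_smul (T ^ i) c H)).trans (map_smul (pairingForm d ρ) c _))

/-- For fixed `ρ` and `H`, the pairing of `ρ` with `A H` is linear in the operator `A`, so the
minimal polynomial of `T` applies. -/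
theorem timeSeries_eq_zero {T : Module.End ℝ (Herm d)} {ρ H : Herm d}
    (h : ∀ j < minpolyDegree T, timeSeries T ρ H j = 0) : timeSeries T ρ H = 0 :=
  funext fun i => LinearMap.map_pow_eq_zero_of_lt_natDegree_minpoly
    (Algebra.IsIntegral.isIntegral T) ((pairingForm d ρ).comp (LinearMap.applyₗ H)) h i

end QuantumSeries

theorem mainTheorem4 (d : ℕ) (ρ₀ H₀ : QuantumSeries.Herm d) (S : Set (QuantumSeries.Herm d))
    (T : Module.End ℝ (QuantumSeries.Herm d)) (hT : T ∈ QuantumSeries.unitalMaps d) :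
    -- topological manifolds (in the subspace topology) of dimension `n > δ`
    (∀ n : ℕ, S.Nonempty → Nonempty (ChartedSpace (EuclideanSpace ℝ (Fin n)) S) →
      QuantumSeries.minpolyDegree T < n →
        ¬ Set.InjOn (fun ρ => QuantumSeries.timeSeries T ρ H₀) S ∧
        ¬ Set.InjOn (fun H => QuantumSeries.timeSeries T ρ₀ H) S) ∧
    -- bounded sets of Minkowski dimension `> δ`; the sequences are measured by any seminorm
    -- on any linear space of real sequences that contains the time series
    (Bornology.IsBounded S →
      ((QuantumSeries.minpolyDegree T : ℕ) : EReal) < QuantumSeries.minkowskiDim S →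
        (∀ (W : Submodule ℝ (ℕ → ℝ)) (p : Seminorm ℝ W)
          (hW : ∀ ρ ∈ S, QuantumSeries.timeSeries T ρ H₀ ∈ W),
          ¬ QuantumSeries.HasLipschitzInverse p
            (fun ρ : S => (⟨QuantumSeries.timeSeries T ρ H₀, hW ρ ρ.2⟩ : W))) ∧
        (∀ (W : Submodule ℝ (ℕ → ℝ)) (p : Seminorm ℝ W)
          (hW : ∀ H ∈ S, QuantumSeries.timeSeries T ρ₀ H ∈ W),
          ¬ QuantumSeries.HasLipschitzInverse p
            (fun H : S => (⟨QuantumSeries.timeSeries T ρ₀ H, hW H H.2⟩ : W)))) := by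
  let F := QuantumSeries.timeSeriesForm T
  refine ⟨fun n hS hM hn => ⟨?_, ?_⟩, fun hS hm => ⟨fun W p hW => ?_, fun W p hW => ?_⟩⟩
  · exact QuantumSeries.not_injOn_of_chartedSpace (f := F.flip H₀)
      (fun _ => QuantumSeries.timeSeries_eq_zero) hS hM hn
  · exact QuantumSeries.not_injOn_of_chartedSpace (f := F ρ₀)
      (fun _ => QuantumSeries.timeSeries_eq_zero) hS hM hn
  · exact QuantumSeries.not_hasLipschitzInverse_of_lt_minkowskiDim (f := F.flip H₀)
      (fun _ => QuantumSeries.timeSeries_eq_zero) hS hm W p hW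
  · exact QuantumSeries.not_hasLipschitzInverse_of_lt_minkowskiDim (f := F ρ₀)
      (fun _ => QuantumSeries.timeSeries_eq_zero) hS hm W p hW
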